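/- Let $e_1,e_2$ be an orthonormal basis of $\mathbb R^2$, and let $\rho_1,\rho_2:\mathbb R\to(0,\infty)$ be continuous and periodic with periods $T_1,T_2>0$ respectively, such that the density $\rho(x)=\rho_1(x\cdot e_1)\,\rho_2(x\cdot e_2)$ is doubly periodic on the unit square, i.e. $\rho(x+k)=\rho(x)$ for all $x\in\mathbb R^2$, $k\in\mathbb Z^2$. Put $$\theta_i=\frac1{T_i}\int_0^{T_i}\rho_i(s)\,ds,\qquad R_i(t)=\int_0^t\rho_i(s)\,ds\qquad(i=1,2),$$ so that $\theta_i=\int_0^1\rho_i$ when $T_i=1$. A $C^2$ function $P:\mathbb R^2\to\mathbb R$ is called a doubly-periodic solution of the Monge–Ampère equation if $$H(P)(\xi)\;\rho_1\big(\nabla P(\xi)\cdot e_1\big)\,\rho_2\big(\nabla P(\xi)\cdot e_2\big)=\theta_1\theta_2\qquad\text{for all }\xi\in\mathbb R^2,$$ where $H(P)=\partial_{11}P\,\partial_{22}P-(\partial_{12}P)^2$ is the Hessian determinant of $P$, and the map $x=\nabla P$ is doubly periodic and fixes the origin: $\nabla P(\xi+k)=\nabla P(\xi)+k$ for all $\xi\in\mathbb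 R^2$, $k\in\mathbb Z^2$, and $\nabla P(0)=0$. Then $R_1$ and $R_2$ are bijections of $\mathbb R$, and there are differentiable functions $F,G:\mathbb R\to\mathbb R$ with $$F'(t)=R_1^{-1}(\theta_1t),\qquad G'(t)=R_2^{-1}(\theta_2t)\qquad(t\in\mathbb R),$$ such that $F'(t)-t$ is $T_1$-periodic, $G'(t)-t$ is $T_2$-periodic, and the separable function $$P(\xi)=F(\xi\cdot e_1)+G(\xi\cdot e_2)$$ is a convex doubly-periodic solution of the Monge–Ampère equation. Moreover, this solution is unique up to an additive constant: if $Q$ is any doubly-periodic solution (not assumed separable or convex), then $Q=P+c$ for some constant $c\in\mathbb R$. -/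

import Mathlib

/-- The Euclidean plane, carrying both the computational and the physical coordinates. -/
abbrev Plane : Type := EuclideanSpace ℝ (Fin 2)

/-- The vector of the period lattice `ℤ²` of the unit square with integer coordinates `k`. -/
noncomputable def latticeVec (k : Fin 2 → ℤ) : Plane :=
  WithLp.toLp 2 (fun i => (k i : ℝ))

/-- A scalar function on the plane is doubly periodic over the unit square. -/
def DoublyPeriodic (f : Plane → ℝ) : Prop :=
  ∀ (x : Plane) (k : Fin 2 → ℤ), f (x + latticeVec k) = f x

/-- A map of the plane is doubly periodic as a map from one periodic unit square to another:
translating the argument by a lattice vector translates the value by the same vector. -/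
def DoublyPeriodicMap (X : Plane → Plane) : Prop :=
  ∀ (ξ : Plane) (k : Fin 2 → ℤ), X (ξ + latticeVec k) = X ξ + latticeVec k

/-- The Hessian matrix of second partial derivatives of `P` at `ξ`. -/
noncomputable def hessianMatrix (P : Plane → ℝ) (ξ : Plane) : Matrix (Fin 2) (Fin 2) ℝ :=
  Matrix.of fun i j =>
    iteratedFDeriv ℝ 2 P ξ ![EuclideanSpace.single i (1 : ℝ), EuclideanSpace.single j (1 : ℝ)]

/-- The Hessian determinant `H(P) = P_ξξ P_ηη - P_ξη²`. -/
noncomputable def hessianDet (P : Plane → ℝ) (ξ : Plane) : ℝ :=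
  (hessianMatrix P ξ).det

/-- The density `ρ(x) = ρ₁(x·e₁) ρ₂(x·e₂)`. -/
noncomputable def productDensity (ρ₁ ρ₂ : ℝ → ℝ) (e₁ e₂ : Plane) (x : Plane) : ℝ :=
  ρ₁ (inner ℝ x e₁) * ρ₂ (inner ℝ x e₂)

/-- The mean value of `r` over the interval `[0, T]`; for `T = 1` it is `∫₀¹ r`. -/
noncomputable def meanOver (r : ℝ → ℝ) (T : ℝ) : ℝ :=
  (∫ s in (0 : ℝ)..T, r s) / T

/-- The cumulative density `R(t) = ∫₀ᵗ r`. -/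
noncomputable def cumulative (r : ℝ → ℝ) (t : ℝ) : ℝ :=
  ∫ s in (0 : ℝ)..t, r s

/-- `P` is a classical (twice continuously differentiable) solution of the Monge–Ampère equation
`H(P) ρ(∇P) = θ` on the periodic unit square: its gradient is a doubly periodic map, normalised to
send the origin to the origin. -/
structure IsPeriodicMongeAmpereSolution (ρ : Plane → ℝ) (θ : ℝ) (P : Plane → ℝ) : Prop where
  contDiff : ContDiff ℝ 2 P
  periodic : DoublyPeriodicMap (gradient P)
  gradient_zero : gradient P 0 = 0
  equation : ∀ ξ : Plane, hessianDet P ξ * ρ (gradient P ξ) = θ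

/-! ### Cumulative densities, their periods, and the one-dimensional optimal map. -/

section Cumulative

variable {r : ℝ → ℝ}

/-! Existence is one-dimensional: the Hessian determinant of a separable function in an orthonormal
frame is `F'' G''`, and `quantile` solves `f' ρ(f) = θ` in each variable. Compatibility with `ℤ²`
needs `R(t + a) = R(t) + θ a` for every period `a` of the density, not only for `T`
(`cumulative_period`); double periodicity of the product makes each projected lattice vector such a
period.

For uniqueness, straighten `∇Q` to the map `Y` with frame coordinates `R_i(∇Q · e_i) / θ_i`. The
equation says `det DY = 1`, and `Y - id` is doubly periodic. Since `DY` is a positive diagonal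
matrix times a symmetric one, AM-GM gives `(tr DY)² ≥ 4` without convexity (`trace_gap`). So `div (Y
- id) = tr DY - 2` is either `≥ 0` or `≤ -4`; continuity forbids both from occurring, and its mean
over a cell is zero, so it vanishes (`divergence_eq_zero_of_gap`). Equality in AM-GM forces `DY = 1`
(`eq_one_of_trace_eq`), and the normalisation at the origin gives `Y = id`, which determines `∇Q`.
-/

theorem hasDerivAt_cumulative (hc : Continuous r) (t : ℝ) :
    HasDerivAt (cumulative r) (r t) t :=
  intervalIntegral.integral_hasDerivAt_right (hc.intervalIntegrable _ _)
    (hc.stronglyMeasurableAtFilter _ _) hc.continuousAt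

theorem continuous_cumulative (hc : Continuous r) : Continuous (cumulative r) :=
  continuous_iff_continuousAt.2 fun t => (hasDerivAt_cumulative hc t).continuousAt

theorem cumulative_zero (r : ℝ → ℝ) : cumulative r 0 = 0 := by simp [cumulative]

theorem strictMono_cumulative (hc : Continuous r) (hpos : ∀ t, 0 < r t) :
    StrictMono (cumulative r) :=
  strictMono_of_deriv_pos fun t => by
    rw [(hasDerivAt_cumulative hc t).deriv]; exact hpos t

variable {T : ℝ}

theorem cumulative_bijective (hc : Continuous r) (hpos : ∀ t, 0 < r t) (hT : 0 < T)
    (hper : Function.Periodic r T) : Function.Bijective (cumulative r) :=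
  ⟨(strictMono_cumulative hc hpos).injective, (continuous_cumulative hc).surjective
    (hper.tendsto_atTop_intervalIntegral_of_pos' (hc.intervalIntegrable _ _) hpos hT)
    (hper.tendsto_atBot_intervalIntegral_of_pos' (hc.intervalIntegrable _ _) hpos hT)⟩

theorem meanOver_pos (hc : Continuous r) (hpos : ∀ t, 0 < r t) (hT : 0 < T) :
    0 < meanOver r T :=
  div_pos (intervalIntegral.intervalIntegral_pos_of_pos (hc.intervalIntegrable _ _) hpos hT) hT

theorem cumulative_add (hc : Continuous r) {a : ℝ} (ha : Function.Periodic r a) (t : ℝ) :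
    cumulative r (t + a) = cumulative r t + cumulative r a := by
  have h := ha.intervalIntegral_add_eq_add 0 t fun _ _ => hc.intervalIntegrable _ _
  rwa [zero_add] at h

/-- The increment of the cumulative density over any period is the mean times that period. -/
theorem cumulative_period (hc : Continuous r) (hT : 0 < T) (hper : Function.Periodic r T)
    {a : ℝ} (ha : Function.Periodic r a) : cumulative r a = meanOver r T * a := by
  have hRT : cumulative r T = meanOver r T * T := by
    rw [meanOver, div_mul_cancel₀ _ hT.ne', cumulative]
  -- `R(t) - θ t` is continuous and periodic, hence bounded, while at `t = n a` it equals `n (R(a) -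
  -- θ a)`: a nonzero defect would grow without bound.
  have hbd : Function.Periodic (fun t => cumulative r t - meanOver r T * t) T := fun t => by
    simp only [cumulative_add hc hper, hRT]; ring
  obtain ⟨M, hM⟩ := (hbd.isBounded_of_continuous hT.ne'
    ((continuous_cumulative hc).sub (continuous_const.mul continuous_id))).exists_norm_le
  have hn : ∀ n : ℕ, cumulative r (n * a) = n * cumulative r a := by
    intro n
    induction n with
    | zero => simp [cumulative_zero]
    | succ n ih => push_cast; rw [add_mul, one_mul, cumulative_add hc ha, ih]; ring
  by_contra hne
  have hD : 0 < |cumulative r a - meanOver r T * a| := abs_pos.2 (sub_ne_zero.2 hne)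
  obtain ⟨n, hn'⟩ := exists_nat_gt (M / |cumulative r a - meanOver r T * a|)
  rw [div_lt_iff₀ hD] at hn'
  have h := hM _ ⟨n * a, rfl⟩
  simp only [hn, Real.norm_eq_abs] at h
  rw [show (n : ℝ) * cumulative r a - meanOver r T * (n * a)
    = n * (cumulative r a - meanOver r T * a) by ring, abs_mul, Nat.abs_cast] at h
  linarith

theorem cumulative_add_period (hc : Continuous r) (hT : 0 < T) (hper : Function.Periodic r T)
    {a : ℝ} (ha : Function.Periodic r a) (t : ℝ) :
    cumulative r (t + a) = cumulative r t + meanOver r T * a := by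
  rw [cumulative_add hc ha, cumulative_period hc hT hper ha]

/-- A positive continuous periodic function which is multiplied by a constant under a translation
is invariant under that translation. -/
theorem periodic_of_translate_eq_mul (hc : Continuous r) (hpos : ∀ t, 0 < r t) (hT : 0 < T)
    (hper : Function.Periodic r T) {a c : ℝ} (h : ∀ t, r (t + a) = c * r t) :
    Function.Periodic r a := by
  have hI := intervalIntegral.intervalIntegral_pos_of_pos (hc.intervalIntegrable 0 T) hpos hT
  -- Translation preserves the integral over a full period, which is positive, so the factor `c`
  -- must be `1`.
  have h1 : ∫ s in (0 : ℝ)..T, r (s + a) = ∫ s in (0 : ℝ)..T, r s := by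
    rw [intervalIntegral.integral_comp_add_right, zero_add, add_comm T a,
      hper.intervalIntegral_add_eq a 0, zero_add]
  simp only [h, intervalIntegral.integral_const_mul] at h1
  have hc1 : c = 1 := by
    have : (c - 1) * ∫ s in (0 : ℝ)..T, r s = 0 := by linarith
    rcases mul_eq_zero.1 this with h | h <;> linarith
  intro t; rw [h, hc1, one_mul]

/-- The optimal map `t ↦ R⁻¹(θ t)` in one dimension, `R` being the cumulative density. -/
noncomputable def quantile (r : ℝ → ℝ) (θ t : ℝ) : ℝ :=
  Function.invFun (cumulative r) (θ * t)

variable {θ : ℝ}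

theorem cumulative_quantile (hb : Function.Bijective (cumulative r)) (t : ℝ) :
    cumulative r (quantile r θ t) = θ * t :=
  Function.rightInverse_invFun hb.2 _

theorem eq_quantile (hb : Function.Bijective (cumulative r)) {s t : ℝ}
    (h : cumulative r s = θ * t) : s = quantile r θ t :=
  hb.1 (h.trans (cumulative_quantile hb t).symm)

theorem continuous_quantile (hc : Continuous r) (hpos : ∀ t, 0 < r t)
    (hb : Function.Bijective (cumulative r)) : Continuous (quantile r θ) := by
  let e := (strictMono_cumulative hc hpos).orderIsoOfSurjective _ hb.2
  have : quantile r θ = fun t => e.symm (θ * t) := by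
    funext t
    exact (eq_quantile hb (e.apply_symm_apply (θ * t))).symm
  rw [this]
  exact e.symm.continuous.comp (continuous_const.mul continuous_id)

theorem hasDerivAt_quantile (hc : Continuous r) (hpos : ∀ t, 0 < r t)
    (hb : Function.Bijective (cumulative r)) (hθ : 0 < θ) (t : ℝ) :
    HasDerivAt (quantile r θ) (θ / r (quantile r θ t)) t := by
  -- The map is inverse to `R / θ`, whose derivative `r / θ` never vanishes.
  have h := HasDerivAt.of_local_left_inverse (f := fun s => cumulative r s / θ)
    (continuous_quantile (θ := θ) hc hpos hb).continuousAt
    ((hasDerivAt_cumulative hc (quantile r θ t)).div_const θ)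
    (div_pos (hpos _) hθ).ne'
    (Filter.Eventually.of_forall fun y => by
      rw [cumulative_quantile hb, mul_div_cancel_left₀ _ hθ.ne'])
  rwa [inv_div] at h

theorem quantile_zero (hb : Function.Bijective (cumulative r)) : quantile r θ 0 = 0 :=
  (eq_quantile hb (by rw [cumulative_zero, mul_zero])).symm

theorem quantile_add_period (hc : Continuous r) (hb : Function.Bijective (cumulative r))
    (hT : 0 < T) (hper : Function.Periodic r T) {a : ℝ} (ha : Function.Periodic r a) (t : ℝ) :
    quantile r (meanOver r T) (t + a) = quantile r (meanOver r T) t + a := by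
  refine (eq_quantile hb ?_).symm
  rw [cumulative_add_period hc hT hper ha, cumulative_quantile hb]; ring

end Cumulative

/-! ### Orthonormal frames of the plane and the periods of the two factors. -/

section Plane

theorem Plane.inner_eq (x y : Plane) : inner ℝ x y = x 0 * y 0 + x 1 * y 1 := by
  simp [PiLp.inner_apply, Fin.sum_univ_two, mul_comm]

variable {e₁ e₂ : Plane}

theorem orthonormal_pair_coords (he : Orthonormal ℝ ![e₁, e₂]) :
    e₁ 0 * e₁ 0 + e₁ 1 * e₁ 1 = 1 ∧ e₂ 0 * e₂ 0 + e₂ 1 * e₂ 1 = 1 ∧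
      e₁ 0 * e₂ 0 + e₁ 1 * e₂ 1 = 0 := by
  have h := orthonormal_iff_ite.1 he
  have h11 := h 0 0
  have h22 := h 1 1
  have h12 := h 0 1
  simp only [Matrix.cons_val_zero, Matrix.cons_val_one, Plane.inner_eq] at h11 h22 h12
  exact ⟨by simpa using h11, by simpa using h22, by simpa using h12⟩

theorem orthonormal_pair_inner (he : Orthonormal ℝ ![e₁, e₂]) :
    inner ℝ e₁ e₁ = (1 : ℝ) ∧ inner ℝ e₂ e₂ = (1 : ℝ) ∧
      inner ℝ e₁ e₂ = (0 : ℝ) ∧ inner ℝ e₂ e₁ = (0 : ℝ) := by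
  obtain ⟨h1, h2, h3⟩ := orthonormal_pair_coords he
  rw [real_inner_comm e₁ e₂]
  simp only [Plane.inner_eq]
  exact ⟨h1, h2, h3, h3⟩

/-- A one-sided inverse of a square matrix is two-sided, so orthonormal rows force orthonormal
columns. -/
theorem orthonormal_pair_dual_coords (he : Orthonormal ℝ ![e₁, e₂]) :
    e₁ 0 * e₁ 0 + e₂ 0 * e₂ 0 = 1 ∧ e₁ 1 * e₁ 1 + e₂ 1 * e₂ 1 = 1 ∧
      e₁ 0 * e₁ 1 + e₂ 0 * e₂ 1 = 0 := by
  obtain ⟨h1, h2, h3⟩ := orthonormal_pair_coords he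
  have hM : !![e₁ 0, e₁ 1; e₂ 0, e₂ 1] * !![e₁ 0, e₂ 0; e₁ 1, e₂ 1] = 1 := by
    rw [Matrix.mul_fin_two, h1, h2, h3, mul_comm (e₂ 0), mul_comm (e₂ 1), h3, Matrix.one_fin_two]
  have hM' := mul_eq_one_comm.1 hM
  rw [Matrix.mul_fin_two, Matrix.one_fin_two] at hM'
  have h00 := congrFun (congrFun hM' 0) 0
  have h11 := congrFun (congrFun hM' 1) 1
  have h01 := congrFun (congrFun hM' 0) 1
  exact ⟨by simpa using h00, by simpa using h11, by simpa using h01⟩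

theorem orthonormal_pair_det_sq (he : Orthonormal ℝ ![e₁, e₂]) :
    (e₁ 0 * e₂ 1 - e₁ 1 * e₂ 0) ^ 2 = 1 := by
  obtain ⟨h1, h2, h3⟩ := orthonormal_pair_coords he
  linear_combination (e₂ 0 * e₂ 0 + e₂ 1 * e₂ 1) * h1 + h2
    - (e₁ 0 * e₂ 0 + e₁ 1 * e₂ 1) * h3

theorem eq_inner_smul_add_inner_smul (he : Orthonormal ℝ ![e₁, e₂]) (x : Plane) :
    x = inner ℝ x e₁ • e₁ + inner ℝ x e₂ • e₂ := by
  obtain ⟨h1, h2, h3⟩ := orthonormal_pair_dual_coords he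
  ext i
  fin_cases i <;> simp only [Plane.inner_eq, PiLp.add_apply, PiLp.smul_apply, smul_eq_mul,
    Fin.zero_eta, Fin.mk_one]
  · linear_combination (-x 0) * h1 - x 1 * h3
  · linear_combination (-x 1) * h2 - x 0 * h3

theorem exists_inner_eq (he : Orthonormal ℝ ![e₁, e₂]) (s t : ℝ) :
    ∃ x : Plane, inner ℝ x e₁ = s ∧ inner ℝ x e₂ = t := by
  obtain ⟨h1, h2, h3⟩ := orthonormal_pair_coords he
  refine ⟨s • e₁ + t • e₂, ?_, ?_⟩ <;>
    simp only [Plane.inner_eq, PiLp.add_apply, PiLp.smul_apply, smul_eq_mul]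
  · linear_combination s * h1 + t * h3
  · linear_combination t * h2 + s * h3

theorem Plane.eq_single_add_single (x : Plane) :
    x = x 0 • EuclideanSpace.single (0 : Fin 2) (1 : ℝ)
      + x 1 • EuclideanSpace.single (1 : Fin 2) (1 : ℝ) := by
  ext i; fin_cases i <;> simp

theorem clm_eq_single {M : Type*} [NormedAddCommGroup M] [NormedSpace ℝ M] (L : Plane →L[ℝ] M)
    (x : Plane) :
    L x = x 0 • L (EuclideanSpace.single (0 : Fin 2) (1 : ℝ))
      + x 1 • L (EuclideanSpace.single (1 : Fin 2) (1 : ℝ)) := by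
  conv_lhs => rw [Plane.eq_single_add_single x, map_add, map_smul, map_smul]

/-- The Hessian determinant may be computed in any orthonormal frame. -/
theorem hessianDet_eq (he : Orthonormal ℝ ![e₁, e₂]) (P : Plane → ℝ) (ξ : Plane) :
    hessianDet P ξ =
      fderiv ℝ (fderiv ℝ P) ξ e₁ e₁ * fderiv ℝ (fderiv ℝ P) ξ e₂ e₂ -
        fderiv ℝ (fderiv ℝ P) ξ e₁ e₂ * fderiv ℝ (fderiv ℝ P) ξ e₂ e₁ := by
  have hd := orthonormal_pair_det_sq he
  have hB : ∀ u v : Plane, fderiv ℝ (fderiv ℝ P) ξ u v =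
      u 0 * (v 0 * hessianMatrix P ξ 0 0 + v 1 * hessianMatrix P ξ 0 1) +
        u 1 * (v 0 * hessianMatrix P ξ 1 0 + v 1 * hessianMatrix P ξ 1 1) := by
    intro u v
    have h2 : ∀ w : Plane, fderiv ℝ (fderiv ℝ P) ξ w v = _ := fun w => clm_eq_single _ v
    rw [clm_eq_single (fderiv ℝ (fderiv ℝ P) ξ) u]
    simp only [add_apply, smul_apply, smul_eq_mul, h2,
      hessianMatrix, Matrix.of_apply, iteratedFDeriv_two_apply, Matrix.cons_val_zero,
      Matrix.cons_val_one]
  rw [hessianDet, Matrix.det_fin_two, hB, hB, hB, hB]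
  -- Changing frame multiplies the determinant of a bilinear form by the squared determinant of the
  -- frame, which is `1`.
  linear_combination (hessianMatrix P ξ 0 1 * hessianMatrix P ξ 1 0 -
    hessianMatrix P ξ 0 0 * hessianMatrix P ξ 1 1) * hd

/-- Each factor of a doubly periodic product density is invariant under the projected lattice. -/
theorem periodic_left_of_productDensity (he : Orthonormal ℝ ![e₁, e₂]) {ρ₁ ρ₂ : ℝ → ℝ}
    (hc₁ : Continuous ρ₁) (hpos₁ : ∀ t, 0 < ρ₁ t) (hpos₂ : ∀ t, 0 < ρ₂ t) {T₁ : ℝ}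
    (hT₁ : 0 < T₁) (hper₁ : Function.Periodic ρ₁ T₁)
    (hρ : DoublyPeriodic (productDensity ρ₁ ρ₂ e₁ e₂)) (k : Fin 2 → ℤ) :
    Function.Periodic ρ₁ (inner ℝ (latticeVec k) e₁) := by
  refine periodic_of_translate_eq_mul hc₁ hpos₁ hT₁ hper₁
    (c := ρ₂ 0 / ρ₂ (inner ℝ (latticeVec k) e₂)) fun t => ?_
  -- Freezing the second coordinate at `0` turns lattice invariance of the product into
  -- multiplication of `ρ₁` by a constant.
  obtain ⟨x, hx1, hx2⟩ := exists_inner_eq he t 0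
  have h := hρ x k
  simp only [productDensity, inner_add_left, hx1, hx2, zero_add] at h
  have := (hpos₂ (inner ℝ (latticeVec k) e₂)).ne'
  field_simp
  linarith

theorem periodic_right_of_productDensity (he : Orthonormal ℝ ![e₁, e₂]) {ρ₁ ρ₂ : ℝ → ℝ}
    (hc₂ : Continuous ρ₂) (hpos₁ : ∀ t, 0 < ρ₁ t) (hpos₂ : ∀ t, 0 < ρ₂ t) {T₂ : ℝ}
    (hT₂ : 0 < T₂) (hper₂ : Function.Periodic ρ₂ T₂)
    (hρ : DoublyPeriodic (productDensity ρ₁ ρ₂ e₁ e₂)) (k : Fin 2 → ℤ) :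
    Function.Periodic ρ₂ (inner ℝ (latticeVec k) e₂) := by
  refine periodic_of_translate_eq_mul hc₂ hpos₂ hT₂ hper₂
    (c := ρ₁ 0 / ρ₁ (inner ℝ (latticeVec k) e₁)) fun t => ?_
  obtain ⟨x, hx1, hx2⟩ := exists_inner_eq he 0 t
  have h := hρ x k
  simp only [productDensity, inner_add_left, hx1, hx2, zero_add] at h
  have := (hpos₁ (inner ℝ (latticeVec k) e₁)).ne'
  field_simp
  linarith

end Plane

/-! ### Periodic divergence theorem and the gap argument. -/

section Divergence

/-- The point with coordinates `p` relative to the corner `ξ` of a unit cell. -/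
noncomputable def cellPoint (ξ : Plane) (p : ℝ × ℝ) : Plane :=
  ξ + (p.1 • EuclideanSpace.single (0 : Fin 2) (1 : ℝ)
    + p.2 • EuclideanSpace.single (1 : Fin 2) (1 : ℝ))

theorem continuous_cellPoint (ξ : Plane) : Continuous (cellPoint ξ) := by
  unfold cellPoint; fun_prop

theorem hasFDerivAt_cellPoint (ξ : Plane) (p : ℝ × ℝ) :
    HasFDerivAt (cellPoint ξ)
      ((ContinuousLinearMap.fst ℝ ℝ ℝ).smulRight (EuclideanSpace.single (0 : Fin 2) (1 : ℝ))
        + (ContinuousLinearMap.snd ℝ ℝ ℝ).smulRight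
          (EuclideanSpace.single (1 : Fin 2) (1 : ℝ))) p := by
  have h := ((ContinuousLinearMap.fst ℝ ℝ ℝ).smulRight
        (EuclideanSpace.single (0 : Fin 2) (1 : ℝ))
      + (ContinuousLinearMap.snd ℝ ℝ ℝ).smulRight
        (EuclideanSpace.single (1 : Fin 2) (1 : ℝ))).hasFDerivAt (x := p)
  exact h.const_add ξ

theorem DoublyPeriodic.cellPoint_right {f : Plane → ℝ} (hf : DoublyPeriodic f) (ξ : Plane)
    (x : ℝ) : f (cellPoint ξ (x, 1)) = f (cellPoint ξ (x, 0)) := by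
  rw [← hf (cellPoint ξ (x, 0)) ![0, 1]]
  congr 1
  ext i; fin_cases i <;> simp [cellPoint, latticeVec, add_assoc]

theorem DoublyPeriodic.cellPoint_left {f : Plane → ℝ} (hf : DoublyPeriodic f) (ξ : Plane)
    (y : ℝ) : f (cellPoint ξ (1, y)) = f (cellPoint ξ (0, y)) := by
  rw [← hf (cellPoint ξ (0, y)) ![1, 0]]
  congr 1
  ext i; fin_cases i <;> simp [cellPoint, latticeVec, add_assoc]

/-- The divergence of a doubly periodic vector field has mean zero over every unit cell. -/
theorem integral_divergence_eq_zero {f g : Plane → ℝ} (hf : ContDiff ℝ 1 f) (hg : ContDiff ℝ 1 g)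
    (hfp : DoublyPeriodic f) (hgp : DoublyPeriodic g) (ξ : Plane) :
    ∫ x in (0 : ℝ)..1, ∫ y in (0 : ℝ)..1,
      (fderiv ℝ f (cellPoint ξ (x, y)) (EuclideanSpace.single (0 : Fin 2) (1 : ℝ)) +
        fderiv ℝ g (cellPoint ξ (x, y)) (EuclideanSpace.single (1 : Fin 2) (1 : ℝ))) = 0 := by
  have hfd := fun p => ((hf.differentiable one_ne_zero) (cellPoint ξ p)).hasFDerivAt.comp p
    (hasFDerivAt_cellPoint ξ p)
  have hgd := fun p => ((hg.differentiable one_ne_zero) (cellPoint ξ p)).hasFDerivAt.comp p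
    (hasFDerivAt_cellPoint ξ p)
  have hcp := continuous_cellPoint ξ
  have hf' := (hf.continuous_fderiv one_ne_zero).comp hcp
  have hg' := (hg.continuous_fderiv one_ne_zero).comp hcp
  have key := MeasureTheory.integral2_divergence_prod_of_hasFDerivAt _ _ _ _ 0 0 1 1
    (hf.continuous.comp hcp).continuousOn (hg.continuous.comp hcp).continuousOn
    (fun p _ => hfd p) (fun p _ => hgd p)
    (ContinuousOn.integrableOn_compact (isCompact_uIcc.prod isCompact_uIcc)
      (Continuous.continuousOn (by
        simp only [ContinuousLinearMap.comp_apply]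
        exact (hf'.clm_apply (by fun_prop)).add (hg'.clm_apply (by fun_prop)))))
  simp only [Function.comp_apply, ContinuousLinearMap.comp_apply, add_apply,
    ContinuousLinearMap.smulRight_apply, ContinuousLinearMap.coe_fst',
    ContinuousLinearMap.coe_snd', one_smul, zero_smul, add_zero, zero_add,
    hgp.cellPoint_right, hfp.cellPoint_left, sub_self] at key
  exact key

/-- A nonnegative continuous function with zero integral over a unit cell vanishes at its corner. -/
theorem eq_zero_of_integral_cell_eq_zero {w : Plane → ℝ} (hw : Continuous w) (h0 : ∀ η, 0 ≤ w η)
    (ξ : Plane) (hI : ∫ x in (0 : ℝ)..1, ∫ y in (0 : ℝ)..1, w (cellPoint ξ (x, y)) = 0) :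
    w ξ = 0 := by
  have hc : Continuous fun p : ℝ × ℝ => w (cellPoint ξ p) := hw.comp (continuous_cellPoint ξ)
  by_contra hne
  have hξ : cellPoint ξ (0, 0) = ξ := by simp [cellPoint]
  have hpos : 0 < w (cellPoint ξ (0, 0)) := by rw [hξ]; exact lt_of_le_of_ne (h0 ξ) (Ne.symm hne)
  refine (intervalIntegral.integral_pos one_pos
    (f := fun x => ∫ y in (0 : ℝ)..1, w (cellPoint ξ (x, y))) ?_ ?_ ⟨0, by simp, ?_⟩).ne' hI
  · exact (intervalIntegral.continuous_parametric_intervalIntegral_of_continuous'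
      (f := fun x y => w (cellPoint ξ (x, y))) hc 0 1).continuousOn
  · exact fun x _ => intervalIntegral.integral_nonneg zero_le_one fun y _ => h0 _
  · exact intervalIntegral.integral_pos one_pos
      (hc.comp (by fun_prop : Continuous fun y : ℝ => ((0 : ℝ), y))).continuousOn
      (fun y _ => h0 _) ⟨0, by simp, hpos⟩

variable {e₁ e₂ : Plane}

/-- If the divergence of a doubly periodic vector field, given by its components in an orthonormal
frame, omits the values between `-4` and `0`, then it vanishes. -/
theorem divergence_eq_zero_of_gap {u v : Plane → ℝ} (hu : ContDiff ℝ 1 u) (hv : ContDiff ℝ 1 v)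
    (hup : DoublyPeriodic u) (hvp : DoublyPeriodic v)
    (hgap : ∀ ξ, 0 ≤ fderiv ℝ u ξ e₁ + fderiv ℝ v ξ e₂ ∨
      fderiv ℝ u ξ e₁ + fderiv ℝ v ξ e₂ ≤ -4) (ξ : Plane) :
    fderiv ℝ u ξ e₁ + fderiv ℝ v ξ e₂ = 0 := by
  set w : Plane → ℝ := fun ξ => fderiv ℝ u ξ e₁ + fderiv ℝ v ξ e₂ with hwdef
  have hw : Continuous w :=
    ((hu.continuous_fderiv one_ne_zero).clm_apply continuous_const).add
      ((hv.continuous_fderiv one_ne_zero).clm_apply continuous_const)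
  have hI : ∀ ξ, ∫ x in (0 : ℝ)..1, ∫ y in (0 : ℝ)..1, w (cellPoint ξ (x, y)) = 0 := by
    intro ξ
    -- These are the standard components of the field `u e₁ + v e₂`.
    have h := integral_divergence_eq_zero
      (f := fun η => e₁ 0 * u η + e₂ 0 * v η) (g := fun η => e₁ 1 * u η + e₂ 1 * v η)
      ((contDiff_const.mul hu).add (contDiff_const.mul hv))
      ((contDiff_const.mul hu).add (contDiff_const.mul hv))
      (fun x k => by simp only [hup x k, hvp x k]) (fun x k => by simp only [hup x k, hvp x k]) ξ
    rw [← h]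
    have hud := fun η => (hu.differentiable one_ne_zero) η
    have hvd := fun η => (hv.differentiable one_ne_zero) η
    have hlin : ∀ (a b : ℝ) (η : Plane), fderiv ℝ (fun η => a * u η + b * v η) η
        = a • fderiv ℝ u η + b • fderiv ℝ v η := fun a b η =>
      (((hud η).hasFDerivAt.const_mul a).add ((hvd η).hasFDerivAt.const_mul b)).fderiv
    congr 1; funext x; congr 1; funext y
    simp only [hlin, hwdef]
    rw [clm_eq_single (fderiv ℝ u _) e₁, clm_eq_single (fderiv ℝ v _) e₂]
    simp only [add_apply, smul_apply, smul_eq_mul]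
    ring
  by_cases hex : ∃ η, 0 ≤ w η
  · obtain ⟨η, hη⟩ := hex
    refine eq_zero_of_integral_cell_eq_zero hw (fun ζ => ?_) ξ (hI ξ)
    rcases hgap ζ with h | h
    · exact h
    -- If both signs occurred, the intermediate value theorem would produce the forbidden value
    -- `-2`.
    · obtain ⟨z, hz⟩ := mem_range_of_exists_le_of_exists_ge hw (c := -2)
        ⟨ζ, by simp only [hwdef]; linarith⟩ ⟨η, by linarith⟩
      rcases hgap z with h' | h' <;> · simp only [hwdef] at hz; linarith
  · push Not at hex
    have h := eq_zero_of_integral_cell_eq_zero hw.neg (fun η => (neg_pos.2 (hex η)).le) ξ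
      (by simp [intervalIntegral.integral_neg, hI ξ])
    exact neg_eq_zero.1 h

end Divergence

/-! ### Calculus of separable functions. -/

section Separable

variable {e₁ e₂ : Plane} {F G f g f' g' : ℝ → ℝ}

theorem hasFDerivAt_comp_inner (hF : ∀ t, HasDerivAt F (f t) t) (e ξ : Plane) :
    HasFDerivAt (fun η : Plane => F (inner ℝ η e)) (f (inner ℝ ξ e) • innerSL ℝ e) ξ := by
  have h := (hF (innerSL ℝ e ξ)).comp_hasFDerivAt ξ (innerSL ℝ e).hasFDerivAt
  simp only [Function.comp_def, innerSL_apply_apply] at h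
  simpa only [real_inner_comm] using h

theorem fderiv_separable (hF : ∀ t, HasDerivAt F (f t) t) (hG : ∀ t, HasDerivAt G (g t) t) :
    fderiv ℝ (fun ξ : Plane => F (inner ℝ ξ e₁) + G (inner ℝ ξ e₂)) =
      fun ξ => f (inner ℝ ξ e₁) • innerSL ℝ e₁ + g (inner ℝ ξ e₂) • innerSL ℝ e₂ := by
  funext ξ
  exact ((hasFDerivAt_comp_inner hF e₁ ξ).add (hasFDerivAt_comp_inner hG e₂ ξ)).fderiv

theorem gradient_separable (hF : ∀ t, HasDerivAt F (f t) t) (hG : ∀ t, HasDerivAt G (g t) t)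
    (ξ : Plane) :
    gradient (fun ξ : Plane => F (inner ℝ ξ e₁) + G (inner ℝ ξ e₂)) ξ =
      f (inner ℝ ξ e₁) • e₁ + g (inner ℝ ξ e₂) • e₂ := by
  refine ext_inner_right ℝ fun v => ?_
  rw [inner_gradient_left, fderiv_separable hF hG]
  simp only [add_apply, smul_apply, innerSL_apply_apply, inner_add_left, real_inner_smul_left,
    smul_eq_mul]

theorem contDiff_two_of_hasDerivAt (hF : ∀ t, HasDerivAt F (f t) t)
    (hf : ∀ t, HasDerivAt f (f' t) t) (hf' : Continuous f') : ContDiff ℝ 2 F := by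
  have hdF : deriv F = f := funext fun t => (hF t).deriv
  have hdf : deriv f = f' := funext fun t => (hf t).deriv
  rw [show (2 : WithTop ℕ∞) = 1 + 1 by norm_num, contDiff_succ_iff_deriv, hdF,
    contDiff_one_iff_deriv, hdf]
  exact ⟨fun t => (hF t).differentiableAt, by simp, fun t => (hf t).differentiableAt, hf'⟩

theorem contDiff_separable (hF : ContDiff ℝ 2 F) (hG : ContDiff ℝ 2 G) :
    ContDiff ℝ 2 (fun ξ : Plane => F (inner ℝ ξ e₁) + G (inner ℝ ξ e₂)) :=
  (hF.comp (contDiff_id.inner ℝ contDiff_const)).add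
    (hG.comp (contDiff_id.inner ℝ contDiff_const))

theorem convexOn_separable (hF : ConvexOn ℝ Set.univ F) (hG : ConvexOn ℝ Set.univ G) :
    ConvexOn ℝ Set.univ (fun ξ : Plane => F (inner ℝ ξ e₁) + G (inner ℝ ξ e₂)) := by
  have h1 := hF.comp_linearMap (innerSL ℝ e₁).toLinearMap
  have h2 := hG.comp_linearMap (innerSL ℝ e₂).toLinearMap
  simpa [Function.comp_def, Pi.add_def, real_inner_comm] using h1.add h2

theorem hessianDet_separable (he : Orthonormal ℝ ![e₁, e₂]) (hF : ∀ t, HasDerivAt F (f t) t)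
    (hG : ∀ t, HasDerivAt G (g t) t) (hf : ∀ t, HasDerivAt f (f' t) t)
    (hg : ∀ t, HasDerivAt g (g' t) t) (ξ : Plane) :
    hessianDet (fun ξ : Plane => F (inner ℝ ξ e₁) + G (inner ℝ ξ e₂)) ξ =
      f' (inner ℝ ξ e₁) * g' (inner ℝ ξ e₂) := by
  obtain ⟨i1, i2, i3, i4⟩ := orthonormal_pair_inner he
  rw [hessianDet_eq he, fderiv_separable hF hG, (((hasFDerivAt_comp_inner hf e₁ ξ).smul_const
    (innerSL ℝ e₁)).fun_add ((hasFDerivAt_comp_inner hg e₂ ξ).smul_const (innerSL ℝ e₂))).fderiv]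
  simp only [add_apply, smul_apply, ContinuousLinearMap.smulRight_apply, innerSL_apply_apply,
    i1, i2, i3, i4, smul_eq_mul]
  ring

end Separable

/-! ### Uniqueness: the trace inequality and the straightened gradient map. -/

section Rigidity

variable {e₁ e₂ : Plane}

/-- For a symmetric matrix of positive determinant, scaled to determinant one, the trace omits
`(-2, 2)`. -/
theorem trace_gap {a b x y m : ℝ} (ha : 0 < a) (hb : 0 < b)
    (h : a * b * (x * y - m * m) = 1) :
    0 ≤ (a * x - 1) + (b * y - 1) ∨ (a * x - 1) + (b * y - 1) ≤ -4 := by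
  have hm : 0 ≤ a * b * (m * m) := mul_nonneg (mul_pos ha hb).le (mul_self_nonneg m)
  have hsq : 4 ≤ (a * x + b * y) ^ 2 := by nlinarith [sq_nonneg (a * x - b * y)]
  by_contra hcon
  push Not at hcon
  -- With `s` the divergence, the product is `-s (s + 4) = 4 - (s + 2)²`, and `s + 2` is the trace.
  nlinarith [mul_pos (sub_pos.2 hcon.1) (sub_pos.2 hcon.2)]

/-- The equality case of AM-GM: with trace `2`, the determinant equation becomes `(a x - 1)² + a b
m² = 0`, a sum of two nonnegative terms. -/
theorem eq_one_of_trace_eq {a b x y m : ℝ} (ha : 0 < a) (hb : 0 < b)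
    (h : a * b * (x * y - m * m) = 1) (htr : (a * x - 1) + (b * y - 1) = 0) :
    a * x - 1 = 0 ∧ b * y - 1 = 0 ∧ m = 0 := by
  have hm : 0 ≤ a * b * (m * m) := mul_nonneg (mul_pos ha hb).le (mul_self_nonneg m)
  have hs : b * y - 1 = -(a * x - 1) := by linarith
  have hkey : (a * x - 1) ^ 2 + a * b * (m * m) = 0 := by
    linear_combination (-1) * h + (a * x) * hs
  have hx : a * x - 1 = 0 := by
    have : (a * x - 1) ^ 2 = 0 := le_antisymm (by linarith) (sq_nonneg _)
    exact pow_eq_zero_iff two_ne_zero |>.1 this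
  refine ⟨hx, by rw [hs, hx, neg_zero], ?_⟩
  rw [hx] at hkey
  have : a * b * (m * m) = 0 := by linarith
  exact mul_self_eq_zero.1 ((mul_eq_zero.1 this).resolve_left (mul_pos ha hb).ne')

/-- The displacement, along `e`, of the area-preserving map obtained from `∇Q` by rescaling the
coordinate along `e` to uniform density. -/
noncomputable def displacement (r : ℝ → ℝ) (θ : ℝ) (e : Plane) (Q : Plane → ℝ) (ξ : Plane) : ℝ :=
  cumulative r (fderiv ℝ Q ξ e) / θ - inner ℝ ξ e

variable {r : ℝ → ℝ} {Q : Plane → ℝ}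

theorem hasFDerivAt_displacement (hc : Continuous r) (θ : ℝ) (e : Plane) (hQ : ContDiff ℝ 2 Q)
    (ξ : Plane) :
    HasFDerivAt (displacement r θ e Q)
      ((r (fderiv ℝ Q ξ e) / θ) • (fderiv ℝ (fderiv ℝ Q) ξ).flip e - innerSL ℝ e) ξ := by
  have hd : DifferentiableAt ℝ (fderiv ℝ Q) ξ :=
    (hQ.fderiv_right (m := 1) (by norm_num)).differentiable one_ne_zero ξ
  have h1 : HasFDerivAt (fun η => fderiv ℝ Q η e) ((fderiv ℝ (fderiv ℝ Q) ξ).flip e) ξ := by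
    have h := hd.hasFDerivAt.clm_apply (hasFDerivAt_const e ξ)
    simpa using h
  have h2 := ((hasDerivAt_cumulative hc (fderiv ℝ Q ξ e)).div_const θ).comp_hasFDerivAt ξ h1
  have h3 := hasFDerivAt_comp_inner (F := id) (f := fun _ => 1) (fun t => hasDerivAt_id t) e ξ
  rw [one_smul] at h3
  exact h2.sub h3

theorem contDiff_cumulative (hc : Continuous r) : ContDiff ℝ 1 (cumulative r) := by
  rw [contDiff_one_iff_deriv, funext fun t => (hasDerivAt_cumulative hc t).deriv]
  exact ⟨fun t => (hasDerivAt_cumulative hc t).differentiableAt, hc⟩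

theorem contDiff_displacement (hc : Continuous r) (θ : ℝ) (e : Plane) (hQ : ContDiff ℝ 2 Q) :
    ContDiff ℝ 1 (displacement r θ e Q) :=
  (((contDiff_cumulative hc).comp
    ((hQ.fderiv_right (m := 1) (by norm_num)).clm_apply contDiff_const)).div_const θ).sub
    (contDiff_id.inner ℝ contDiff_const)

/-- A lattice translation shifts both `R(∂ₑQ) / θ` and `ξ · e` by the projected lattice vector, so
the shifts cancel. -/
theorem doublyPeriodic_displacement (hc : Continuous r) (hpos : ∀ t, 0 < r t) {T : ℝ}
    (hT : 0 < T) (hper : Function.Periodic r T) {e : Plane}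
    (hlat : ∀ k, Function.Periodic r (inner ℝ (latticeVec k) e))
    (hQ : DoublyPeriodicMap (gradient Q)) :
    DoublyPeriodic (displacement r (meanOver r T) e Q) := by
  intro ξ k
  have hθ := (meanOver_pos hc hpos hT).ne'
  have h : fderiv ℝ Q (ξ + latticeVec k) e = fderiv ℝ Q ξ e + inner ℝ (latticeVec k) e := by
    rw [← inner_gradient_left, hQ ξ k, inner_add_left, inner_gradient_left]
  rw [displacement, h, cumulative_add_period hc hT hper (hlat k), displacement, inner_add_left]
  field_simp
  ring

theorem eq_zero_of_fderiv_frame_eq_zero (he : Orthonormal ℝ ![e₁, e₂]) {u : Plane → ℝ}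
    (hu : Differentiable ℝ u) (h1 : ∀ ξ, fderiv ℝ u ξ e₁ = 0) (h2 : ∀ ξ, fderiv ℝ u ξ e₂ = 0)
    (h0 : u 0 = 0) (ξ : Plane) : u ξ = 0 := by
  rw [← h0]
  refine is_const_of_fderiv_eq_zero (𝕜 := ℝ) hu (fun η => ?_) ξ 0
  ext v
  rw [eq_inner_smul_add_inner_smul he v]
  simp [h1, h2]

/-- The gradient of every doubly periodic solution for a product density is the product of the
one-dimensional optimal maps. -/
theorem IsPeriodicMongeAmpereSolution.gradient_eq (he : Orthonormal ℝ ![e₁, e₂])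
    {ρ₁ ρ₂ : ℝ → ℝ} (hc₁ : Continuous ρ₁) (hc₂ : Continuous ρ₂)
    (hpos₁ : ∀ t, 0 < ρ₁ t) (hpos₂ : ∀ t, 0 < ρ₂ t) {T₁ T₂ : ℝ} (hT₁ : 0 < T₁) (hT₂ : 0 < T₂)
    (hper₁ : Function.Periodic ρ₁ T₁) (hper₂ : Function.Periodic ρ₂ T₂)
    (hρ : DoublyPeriodic (productDensity ρ₁ ρ₂ e₁ e₂))
    (hQ : IsPeriodicMongeAmpereSolution (productDensity ρ₁ ρ₂ e₁ e₂)
      (meanOver ρ₁ T₁ * meanOver ρ₂ T₂) Q) (ξ : Plane) :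
    gradient Q ξ = quantile ρ₁ (meanOver ρ₁ T₁) (inner ℝ ξ e₁) • e₁ +
      quantile ρ₂ (meanOver ρ₂ T₂) (inner ℝ ξ e₂) • e₂ := by
  obtain ⟨i1, i2, i3, i4⟩ := orthonormal_pair_inner he
  have hθ₁ := meanOver_pos hc₁ hpos₁ hT₁
  have hθ₂ := meanOver_pos hc₂ hpos₂ hT₂
  have hb₁ := cumulative_bijective hc₁ hpos₁ hT₁ hper₁
  have hb₂ := cumulative_bijective hc₂ hpos₂ hT₂ hper₂
  set θ₁ := meanOver ρ₁ T₁
  set θ₂ := meanOver ρ₂ T₂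
  set u := displacement ρ₁ θ₁ e₁ Q
  set v := displacement ρ₂ θ₂ e₂ Q
  set a : Plane → ℝ := fun η => ρ₁ (fderiv ℝ Q η e₁) / θ₁ with hadef
  set b : Plane → ℝ := fun η => ρ₂ (fderiv ℝ Q η e₂) / θ₂ with hbdef
  have ha : ∀ η, 0 < a η := fun η => div_pos (hpos₁ _) hθ₁
  have hb : ∀ η, 0 < b η := fun η => div_pos (hpos₂ _) hθ₂
  have hu := contDiff_displacement hc₁ θ₁ e₁ hQ.contDiff
  have hv := contDiff_displacement hc₂ θ₂ e₂ hQ.contDiff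
  have hsymm : ∀ η, fderiv ℝ (fderiv ℝ Q) η e₂ e₁ = fderiv ℝ (fderiv ℝ Q) η e₁ e₂ := fun η =>
    hQ.contDiff.contDiffAt.isSymmSndFDerivAt (by simp) e₂ e₁
  have u1 : ∀ η, fderiv ℝ u η e₁ = a η * fderiv ℝ (fderiv ℝ Q) η e₁ e₁ - 1 := fun η => by
    rw [(hasFDerivAt_displacement hc₁ θ₁ e₁ hQ.contDiff η).fderiv]
    simp only [sub_apply, smul_apply, ContinuousLinearMap.flip_apply, innerSL_apply_apply,
      smul_eq_mul, i1, hadef]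
  have u2 : ∀ η, fderiv ℝ u η e₂ = a η * fderiv ℝ (fderiv ℝ Q) η e₁ e₂ := fun η => by
    rw [(hasFDerivAt_displacement hc₁ θ₁ e₁ hQ.contDiff η).fderiv]; simp [i3, hadef, hsymm]
  have v1 : ∀ η, fderiv ℝ v η e₁ = b η * fderiv ℝ (fderiv ℝ Q) η e₁ e₂ := fun η => by
    rw [(hasFDerivAt_displacement hc₂ θ₂ e₂ hQ.contDiff η).fderiv]; simp [i4, hbdef]
  have v2 : ∀ η, fderiv ℝ v η e₂ = b η * fderiv ℝ (fderiv ℝ Q) η e₂ e₂ - 1 := fun η => by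
    rw [(hasFDerivAt_displacement hc₂ θ₂ e₂ hQ.contDiff η).fderiv]
    simp only [sub_apply, smul_apply, ContinuousLinearMap.flip_apply, innerSL_apply_apply,
      smul_eq_mul, i2, hbdef]
  -- The Monge–Ampère equation divided by `θ₁ θ₂`: the straightened map preserves area.
  have hdet : ∀ η, a η * b η * (fderiv ℝ (fderiv ℝ Q) η e₁ e₁ * fderiv ℝ (fderiv ℝ Q) η e₂ e₂ -
      fderiv ℝ (fderiv ℝ Q) η e₁ e₂ * fderiv ℝ (fderiv ℝ Q) η e₁ e₂) = 1 := fun η => by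
    have h := hQ.equation η
    rw [hessianDet_eq he, hsymm, productDensity, inner_gradient_left, inner_gradient_left] at h
    simp only [hadef, hbdef]
    field_simp
    linarith
  have hdiv := divergence_eq_zero_of_gap (e₁ := e₁) (e₂ := e₂) hu hv
    (doublyPeriodic_displacement hc₁ hpos₁ hT₁ hper₁
      (periodic_left_of_productDensity he hc₁ hpos₁ hpos₂ hT₁ hper₁ hρ) hQ.periodic)
    (doublyPeriodic_displacement hc₂ hpos₂ hT₂ hper₂
      (periodic_right_of_productDensity he hc₂ hpos₁ hpos₂ hT₂ hper₂ hρ) hQ.periodic)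
    (fun η => by
      have h := trace_gap (ha η) (hb η) (hdet η)
      rwa [← u1, ← v2] at h)
  have hone := fun η => eq_one_of_trace_eq (ha η) (hb η) (hdet η) (by
    have h := hdiv η
    rwa [u1, v2] at h)
  -- The normalisation at the origin makes the constant displacement zero.
  have hgrad0 : ∀ e, fderiv ℝ Q 0 e = 0 := fun e => by
    rw [← inner_gradient_left, hQ.gradient_zero, inner_zero_left]
  have hu0 := eq_zero_of_fderiv_frame_eq_zero he (hu.differentiable one_ne_zero)
    (fun η => (u1 η).trans (hone η).1)
    (fun η => (u2 η).trans (by rw [(hone η).2.2, mul_zero]))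
    (by simp [displacement, hgrad0, cumulative_zero]) ξ
  have hv0 := eq_zero_of_fderiv_frame_eq_zero he (hv.differentiable one_ne_zero)
    (fun η => (v1 η).trans (by rw [(hone η).2.2, mul_zero]))
    (fun η => (v2 η).trans (hone η).2.1)
    (by simp [displacement, hgrad0, cumulative_zero]) ξ
  rw [displacement, sub_eq_zero, div_eq_iff hθ₁.ne', mul_comm] at hu0
  rw [displacement, sub_eq_zero, div_eq_iff hθ₂.ne', mul_comm] at hv0
  rw [eq_inner_smul_add_inner_smul he (gradient Q ξ), inner_gradient_left, inner_gradient_left,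
    eq_quantile hb₁ hu0, eq_quantile hb₂ hv0]

theorem exists_eq_add_const_of_gradient_eq {P : Plane → ℝ} (hP : Differentiable ℝ P)
    (hQ : Differentiable ℝ Q) (h : ∀ ξ, gradient Q ξ = gradient P ξ) :
    ∃ c : ℝ, ∀ ξ, Q ξ = P ξ + c := by
  refine ⟨Q 0 - P 0, fun ξ => ?_⟩
  have hconst := is_const_of_fderiv_eq_zero (𝕜 := ℝ) (hQ.sub hP) (fun η => by
    rw [fderiv_sub (hQ η) (hP η), sub_eq_zero]
    ext v
    rw [← inner_gradient_left, ← inner_gradient_left, h]) ξ 0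
  simp only [Pi.sub_apply] at hconst
  linarith

end Rigidity

/-! ### Assembly of existence and uniqueness. -/

theorem mainTheorem1 (e₁ e₂ : Plane) (he : Orthonormal ℝ ![e₁, e₂])
    (ρ₁ ρ₂ : ℝ → ℝ) (hc₁ : Continuous ρ₁) (hc₂ : Continuous ρ₂)
    (hpos₁ : ∀ t, 0 < ρ₁ t) (hpos₂ : ∀ t, 0 < ρ₂ t)
    (T₁ T₂ : ℝ) (hT₁ : 0 < T₁) (hT₂ : 0 < T₂)
    (hper₁ : Function.Periodic ρ₁ T₁) (hper₂ : Function.Periodic ρ₂ T₂)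
    (hρ : DoublyPeriodic (productDensity ρ₁ ρ₂ e₁ e₂))
    (θ₁ θ₂ : ℝ) (hθ₁ : θ₁ = meanOver ρ₁ T₁) (hθ₂ : θ₂ = meanOver ρ₂ T₂) :
    Function.Bijective (cumulative ρ₁) ∧ Function.Bijective (cumulative ρ₂) ∧
    ∃ (F G : ℝ → ℝ) (P : Plane → ℝ),
      (∀ t, HasDerivAt F (Function.invFun (cumulative ρ₁) (θ₁ * t)) t) ∧
      (∀ t, HasDerivAt G (Function.invFun (cumulative ρ₂) (θ₂ * t)) t) ∧
      Function.Periodic (fun t => deriv F t - t) T₁ ∧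
      Function.Periodic (fun t => deriv G t - t) T₂ ∧
      (∀ ξ, P ξ = F (inner ℝ ξ e₁) + G (inner ℝ ξ e₂)) ∧
      ConvexOn ℝ Set.univ P ∧
      IsPeriodicMongeAmpereSolution (productDensity ρ₁ ρ₂ e₁ e₂) (θ₁ * θ₂) P ∧
      ∀ Q : Plane → ℝ,
        IsPeriodicMongeAmpereSolution (productDensity ρ₁ ρ₂ e₁ e₂) (θ₁ * θ₂) Q →
          ∃ c : ℝ, ∀ ξ, Q ξ = P ξ + c := by
  subst hθ₁ hθ₂
  have hθ₁ := meanOver_pos hc₁ hpos₁ hT₁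
  have hθ₂ := meanOver_pos hc₂ hpos₂ hT₂
  have hb₁ := cumulative_bijective hc₁ hpos₁ hT₁ hper₁
  have hb₂ := cumulative_bijective hc₂ hpos₂ hT₂ hper₂
  -- `F` and `G` are the primitives from `0` of the optimal maps, so `cumulative` is reused with
  -- `quantile` as integrand.
  have hF := hasDerivAt_cumulative (continuous_quantile (θ := meanOver ρ₁ T₁) hc₁ hpos₁ hb₁)
  have hG := hasDerivAt_cumulative (continuous_quantile (θ := meanOver ρ₂ T₂) hc₂ hpos₂ hb₂)
  have hf := hasDerivAt_quantile hc₁ hpos₁ hb₁ hθ₁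
  have hg := hasDerivAt_quantile hc₂ hpos₂ hb₂ hθ₂
  set f := quantile ρ₁ (meanOver ρ₁ T₁) with hfdef
  set g := quantile ρ₂ (meanOver ρ₂ T₂) with hgdef
  have hdF : deriv (cumulative f) = f := funext fun t => (hF t).deriv
  have hdG : deriv (cumulative g) = g := funext fun t => (hG t).deriv
  have hfc : Continuous f := continuous_quantile hc₁ hpos₁ hb₁
  have hgc : Continuous g := continuous_quantile hc₂ hpos₂ hb₂
  have hfmono : Monotone f := monotone_of_deriv_nonneg (fun t => (hf t).differentiableAt)
    fun t => by rw [(hf t).deriv]; exact (div_pos hθ₁ (hpos₁ _)).le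
  have hgmono : Monotone g := monotone_of_deriv_nonneg (fun t => (hg t).differentiableAt)
    fun t => by rw [(hg t).deriv]; exact (div_pos hθ₂ (hpos₂ _)).le
  have hP := contDiff_separable (e₁ := e₁) (e₂ := e₂)
    (contDiff_two_of_hasDerivAt hF hf (continuous_const.div (hc₁.comp hfc) fun t => (hpos₁ _).ne'))
    (contDiff_two_of_hasDerivAt hG hg (continuous_const.div (hc₂.comp hgc) fun t => (hpos₂ _).ne'))
  have hgrad := gradient_separable (e₁ := e₁) (e₂ := e₂) hF hG
  refine ⟨hb₁, hb₂, cumulative f, cumulative g,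
    fun ξ => cumulative f (inner ℝ ξ e₁) + cumulative g (inner ℝ ξ e₂), hF, hG, ?_, ?_,
    fun _ => rfl, ?_, ⟨hP, ?_, ?_, ?_⟩, ?_⟩
  · intro t
    simp only [hdF]
    rw [hfdef, quantile_add_period hc₁ hb₁ hT₁ hper₁ hper₁]; ring
  · intro t
    simp only [hdG]
    rw [hgdef, quantile_add_period hc₂ hb₂ hT₂ hper₂ hper₂]; ring
  · exact convexOn_separable
      (Monotone.convexOn_univ_of_deriv (fun t => (hF t).differentiableAt) (hdF.symm ▸ hfmono))
      (Monotone.convexOn_univ_of_deriv (fun t => (hG t).differentiableAt) (hdG.symm ▸ hgmono))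
  · intro ξ k
    rw [hgrad, hgrad, inner_add_left, inner_add_left, hfdef, hgdef,
      quantile_add_period hc₁ hb₁ hT₁ hper₁
        (periodic_left_of_productDensity he hc₁ hpos₁ hpos₂ hT₁ hper₁ hρ k),
      quantile_add_period hc₂ hb₂ hT₂ hper₂
        (periodic_right_of_productDensity he hc₂ hpos₁ hpos₂ hT₂ hper₂ hρ k)]
    conv_rhs => rw [eq_inner_smul_add_inner_smul he (latticeVec k)]
    module
  · rw [hgrad, inner_zero_left, inner_zero_left, hfdef, hgdef, quantile_zero hb₁,
      quantile_zero hb₂, zero_smul, zero_smul, add_zero]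
  · intro ξ
    rw [hessianDet_separable he hF hG hf hg, productDensity, inner_gradient_left,
      inner_gradient_left, fderiv_separable hF hG]
    obtain ⟨i1, i2, i3, i4⟩ := orthonormal_pair_inner he
    simp only [add_apply, smul_apply, innerSL_apply_apply, i1, i2, i3, i4, smul_eq_mul, mul_one,
      mul_zero, add_zero, zero_add]
    have := (hpos₁ (f (inner ℝ ξ e₁))).ne'
    have := (hpos₂ (g (inner ℝ ξ e₂))).ne'
    field_simp
  · intro Q hQ
    refine exists_eq_add_const_of_gradient_eq (hP.differentiable two_ne_zero)
      (hQ.contDiff.differentiable two_ne_zero) fun ξ => ?_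
    rw [hgrad, hQ.gradient_eq he hc₁ hc₂ hpos₁ hpos₂ hT₁ hT₂ hper₁ hper₂ hρ]
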